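/- Let $G$ be a semi-Markovian graph (SMG): a finite vertex set $V$, directed edges $v\to w$ forming no directed cycle, and bidirected edges $v\leftrightarrow w$ between distinct vertices. Each vertex $v$ is a random variable with a nonempty countable domain. A causal model $M$ consists of finitely many mutually independent exogenous variables $U$ and, for each $v\in V$, a measurable function $f_v$ of some of the other variables in $V$ and of some of the variables in $U$, such that the resulting dependence on $V$ is acyclic. The model \emph{induces} $G$ if $v\to w$ in $G$ exactly when $f_w$ is defined in terms of $v$, and $v\leftrightarrow w$ in $G$ exactly when $v\ne w$ and $f_v,f_w$ share an exogenous variable. (An exogenous variable may occur in more than two functions; models in which each occurs in at most two are included.) $P(V)$ is the distribution of $V$ in $M$, and $P_{\mathbf x}(\mathbf y)$ is the probability of $\mathbf Y=\mathbf y$ after the functions of the variables in $\mathbf X$ are replaced with the constants $\mathbf x$. Let $\mathcal D$ be a class of distributions of $V$. A function $\Phi$ \emph{identifies} $P_{\mathbf x}(\mathbf y)$ in $G$ from distributions in $\mathcal D$ if $P_{\mathbf x}(\mathbf y)=\Phi(P(V),\mathbf x,\mathbf y)$ for all $\mathbf x,\mathbf y$ in every model that induces $G$ and has $P(V)\in\mathcal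 D$; the effect is \emph{identifiable} if such a $\Phi$ exists. A path is a sequence of distinct vertices joined by edges of any kind, traversed in any direction. For $\mathbf Z\subseteq V$, $G[V\setminus\mathbf Z]$ is the induced subgraph with all its directed and bidirected edges. The latent projection $L(G,V\setminus\mathbf Z)$ is the graph on $V\setminus\mathbf Z$ in which, for distinct $v,w$: $v\to w$ if $G$ has a directed path from $v$ to $w$ with all interior vertices in $\mathbf Z$; and $v\leftrightarrow w$ if $G$ has a path between $v$ and $w$ with all interior vertices in $\mathbf Z$, without colliders, whose first edge has an arrowhead at $v$ and whose last edge has an arrowhead at $w$. \textbf{Corollary.} Let $\mathbf X,\mathbf Y\subseteq V$ be disjoint, let $\mathbf W\subseteq\mathbf X$ and $\mathbf Z\subseteq V$ be such that every path from $\mathbf Z$ to $\mathbf Y$ in $G$ contains a vertex of $\mathbf W$, and suppose that no member of $\mathbf X\setminus\mathbf W$ is a descendant of $\mathbf W$. If $\mathbf Z$ contains no member of $\mathbf W$ and $G[V\setminus\mathbf Z]=L(G,V\setminus\mathbf Z)$, then the causal effect $P_{\mathbf x}(\mathbf y)$ obtained from $P$ in $G$ equals the causal effect $P'_{\mathbf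 x\setminus\mathbf z}(\mathbf y)$ obtained from $P'=P(V\setminus\mathbf Z)$ in $G[V\setminus\mathbf Z]$, in the following sense. 1. For every model $M$ that induces $G$ there is a model $M'$ that induces $G[V\setminus\mathbf Z]$, whose distribution is the marginal $P(V\setminus\mathbf Z)$ of $M$, and for which $P_{\mathbf x}(\mathbf y)$ in $M$ equals $P'_{\mathbf x\setminus\mathbf z}(\mathbf y)$ in $M'$ for all $\mathbf x,\mathbf y$. 2. For every class $\mathcal D'$ of distributions of $V\setminus\mathbf Z$: if $\Phi$ identifies $P'_{\mathbf x\setminus\mathbf z}(\mathbf y)$ in $G[V\setminus\mathbf Z]$ from distributions in $\mathcal D'$, then $P_{\mathbf x}(\mathbf y)=\Phi(P(V\setminus\mathbf Z),\mathbf x\setminus\mathbf z,\mathbf y)$ in every model that induces $G$ and whose marginal $P(V\setminus\mathbf Z)$ lies in $\mathcal D'$. 3. $P_{\mathbf x}(\mathbf y)$ is identifiable in $G$ if and only if $P'_{\mathbf x\setminus\mathbf z}(\mathbf y)$ is identifiable in $G[V\setminus\mathbf Z]$, both when all distributions are admitted and when only distributions that give positive probability to every assignment of values are admitted. -/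

import Mathlib

open MeasureTheory

universe u

/-! ### Mixed graphs, paths, induced subgraphs and latent projections -/

/-- A graph with directed edges `v → w` (`dir v w`) and bidirected edges `v ↔ w` (`bi v w`). -/
structure MixedGraph (V : Type u) where
  dir : V → V → Prop
  bi : V → V → Prop

/-- The three ways in which an edge can join `v` to the next vertex `w` of a path:
`v → w`, `v ← w` and `v ↔ w`. -/
inductive Link : Type
  | right
  | left
  | both

/-- The edge has an arrowhead at the vertex that it leaves. -/
def Link.HeadAtStart : Link → Prop
  | .right => False
  | .left => True
  | .both => True

/-- The edge has an arrowhead at the vertex that it reaches. -/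
def Link.HeadAtEnd : Link → Prop
  | .right => True
  | .left => False
  | .both => True

namespace MixedGraph

variable {V : Type u}

/-- Semi-Markovian graphs: the directed edges form no cycle, and the bidirected edges join
unordered pairs of distinct vertices. -/
structure IsSMG (G : MixedGraph V) : Prop where
  acyclic : ∀ v, ¬ Relation.TransGen G.dir v v
  bi_symm : ∀ v w, G.bi v w → G.bi w v
  bi_irrefl : ∀ v, ¬ G.bi v v

/-- `G` contains an edge of the given kind from `v` to `w`. -/
def Joined (G : MixedGraph V) : Link → V → V → Prop
  | .right, v, w => G.dir v w
  | .left, v, w => G.dir w v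
  | .both, v, w => G.bi v w

/-- Walks in `G`, in which edges may be traversed in either direction. -/
inductive Walk (G : MixedGraph V) : V → V → Type u
  | nil (v : V) : Walk G v v
  | cons {v w t : V} (l : Link) (h : G.Joined l v w) (p : Walk G w t) : Walk G v t

namespace Walk

/-- The vertices of a walk, in order, both ends included. -/
def support {G : MixedGraph V} : {v w : V} → G.Walk v w → List V
  | _, _, .nil v => [v]
  | v, _, .cons _ _ p => v :: p.support

/-- The kinds of the edges of a walk, in order. -/
def links {G : MixedGraph V} : {v w : V} → G.Walk v w → List Link
  | _, _, .nil _ => []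
  | _, _, .cons l _ p => l :: p.links

/-- A path is a walk without repeated vertices. -/
def IsPath {G : MixedGraph V} {v w : V} (p : G.Walk v w) : Prop :=
  p.support.Nodup

/-- The vertices of a walk other than its two ends. -/
def interior {G : MixedGraph V} {v w : V} (p : G.Walk v w) : List V :=
  p.support.tail.dropLast

/-- A walk of the form `v → ⋯ → w`. -/
def Directed {G : MixedGraph V} {v w : V} (p : G.Walk v w) : Prop :=
  ∀ l ∈ p.links, l = Link.right

/-- No two consecutive edges of the walk both have an arrowhead at the vertex they share. -/
def NoCollider {G : MixedGraph V} {v w : V} (p : G.Walk v w) : Prop :=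
  p.links.IsChain (fun l l' => ¬ (l.HeadAtEnd ∧ l'.HeadAtStart))

/-- The first edge has an arrowhead at the first vertex, and the last edge has an arrowhead at the
last vertex. -/
def HeadsAtEnds {G : MixedGraph V} {v w : V} (p : G.Walk v w) : Prop :=
  (∀ l ∈ p.links.head?, l.HeadAtStart) ∧ (∀ l ∈ p.links.getLast?, l.HeadAtEnd)

end Walk

/-- `W` intercepts all paths from `A` to `B` (the directions of the edges are ignored). -/
def Intercepts (G : MixedGraph V) (W A B : Set V) : Prop :=
  ∀ a ∈ A, ∀ b ∈ B, ∀ p : G.Walk a b, p.IsPath → ∃ w ∈ W, w ∈ p.support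

/-- The induced subgraph `G[V \ Z]`. -/
def remove (G : MixedGraph V) (Z : Set V) : MixedGraph {v : V // v ∉ Z} where
  dir v w := G.dir v w
  bi v w := G.bi v w

/-- The latent projection `L(G, V \ Z)`: the vertices in `Z` become latent, in addition to the
latent variables that the bidirected edges of `G` stand for. -/
def latentProjection (G : MixedGraph V) (Z : Set V) : MixedGraph {v : V // v ∉ Z} where
  dir v w := v ≠ w ∧ ∃ p : G.Walk v w, p.IsPath ∧ (∀ m ∈ p.interior, m ∈ Z) ∧ p.Directed
  bi v w := v ≠ w ∧ ∃ p : G.Walk v w, p.IsPath ∧ (∀ m ∈ p.interior, m ∈ Z) ∧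
    p.NoCollider ∧ p.HeadsAtEnds

end MixedGraph

/-! ### Causal models -/

/-- An acyclic probabilistic causal model whose endogenous variables are indexed by `V`, the
variable `v` having domain `val v`, and whose exogenous variables `i : U` are mutually independent,
with domains `exo i` and laws `law i`. The function `f v` that determines the variable `v` is
defined in terms of the endogenous `w` with `pa w v` and the exogenous `i` with `lat i v`. -/
structure CausalModel {V : Type u} (val : V → Type u) [∀ v, MeasurableSpace (val v)] where
  pa : V → V → Prop
  acyclic : ∀ v, ¬ Relation.TransGen pa v v
  U : Type u
  fintypeU : Fintype U
  exo : U → Type u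
  measurableSpaceExo : ∀ i, MeasurableSpace (exo i)
  law : ∀ i, Measure (exo i)
  isProbability : ∀ i, IsProbabilityMeasure (law i)
  lat : U → V → Prop
  f : ∀ v, (∀ w : {w : V // pa w v}, val w) → (∀ i : {i : U // lat i v}, exo i) → val v
  measurable_f : ∀ v, Measurable
    (fun a : (∀ w : {w : V // pa w v}, val w) × (∀ i : {i : U // lat i v}, exo i) => f v a.1 a.2)

namespace CausalModel

variable {V : Type u} {val : V → Type u} [∀ v, MeasurableSpace (val v)]

attribute [instance] CausalModel.fintypeU CausalModel.measurableSpaceExo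
  CausalModel.isProbability

/-- `G` is the graph of the model: `v → w` if the function of `w` is defined in terms of `v`, and
`v ↔ w` if the functions of `v` and `w` share an exogenous variable. (This is the latent projection
onto `V` of the causal diagram on `U ∪ V`; if each exogenous variable occurs in at most two
functions, it is the usual abbreviation of `v ← i → w`.) -/
def Induces (M : CausalModel val) (G : MixedGraph V) : Prop :=
  (∀ v w, G.dir v w ↔ M.pa v w) ∧
    ∀ v w, G.bi v w ↔ v ≠ w ∧ ∃ i, M.lat i v ∧ M.lat i w

open Classical in
/-- The submodel for the intervention `do(X = x)`: the functions of the members of `X` are replaced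
by constants. Only the values of `x` on `X` are used. -/
noncomputable def intervene (M : CausalModel val) (X : Set V) (x : ∀ v, val v) :
    CausalModel val :=
  { M with
    f := fun v a b => if v ∈ X then x v else M.f v a b
    measurable_f := by
      intro v
      by_cases h : v ∈ X
      · simp only [h, if_true]
        exact measurable_const
      · simp only [h, if_false]
        exact M.measurable_f v }

theorem wellFounded_pa [Finite V] (M : CausalModel val) : WellFounded M.pa := by
  have : Std.Irrefl (Relation.TransGen M.pa) := ⟨M.acyclic⟩
  have h : WellFounded (Relation.TransGen M.pa) := Finite.wellFounded_of_trans_of_irrefl _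
  exact Subrelation.wf (fun h => Relation.TransGen.single h) h

/-- The values of the endogenous variables when the exogenous ones take the values `e`. -/
noncomputable def solution [Finite V] (M : CausalModel val) (e : ∀ i, M.exo i) : ∀ v, val v :=
  M.wellFounded_pa.fix (fun v rec => M.f v (fun w => rec w.1 w.2) (fun i => e i.1))

theorem solution_eq [Finite V] (M : CausalModel val) (e : ∀ i, M.exo i) (v : V) :
    M.solution e v = M.f v (fun w => M.solution e w.1) (fun i => e i.1) :=
  M.wellFounded_pa.fix_eq _ v

theorem measurable_solution [Finite V] (M : CausalModel val) : Measurable M.solution := by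
  refine measurable_pi_iff.2 fun v => ?_
  induction v using M.wellFounded_pa.induction with
  | _ v ih =>
    rw [show (fun e => M.solution e v) = fun e =>
      M.f v (fun w => M.solution e w.1) (fun i => e i.1) from funext fun e => M.solution_eq e v]
    exact (M.measurable_f v).comp (Measurable.prodMk
      (measurable_pi_iff.2 fun w => ih w.1 w.2)
      (measurable_pi_iff.2 fun i => measurable_pi_apply i.1))

/-- The joint distribution `P(V)` of the endogenous variables. -/
noncomputable def obs [Finite V] (M : CausalModel val) : Measure (∀ v, val v) :=
  (Measure.pi M.law).map M.solution

/-- The causal effect `P_x(y)`: the probability of `Y = y` in the submodel for `do(X = x)`. Only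
the values of `x` on `X` and of `y` on `Y` are used. -/
noncomputable def effect [Finite V] (M : CausalModel val) (X : Set V) (x : ∀ v, val v)
    (Y : Set V) (y : ∀ v, val v) : ENNReal :=
  (M.intervene X x).obs {ω | ∀ v ∈ Y, ω v = y v}

end CausalModel

/-! ### Identification -/

section Identification

variable {V : Type u} {val : V → Type u}

/-- The restriction of an assignment of values to `V \ Z`. -/
def restrictOff (Z : Set V) (ω : ∀ v, val v) : ∀ v : {v : V // v ∉ Z}, val v :=
  fun v => ω v

variable [∀ v, MeasurableSpace (val v)]

/-- The marginal distribution `P(V \ Z)`. -/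
noncomputable def marginalOff (Z : Set V) (P : Measure (∀ v, val v)) :
    Measure (∀ v : {v : V // v ∉ Z}, val v) :=
  P.map (restrictOff Z)

variable (val) in
/-- The distributions that give positive probability to every assignment of values. -/
def positiveDistributions : Set (Measure (∀ v, val v)) :=
  {P | ∀ ω, 0 < P {ω}}

/-- `Φ` computes the causal effect of `X` on `Y` from `P(V)` in every causal model that induces `G`
and has its distribution `P(V)` in the class `D`. -/
def Identifies [Finite V] (G : MixedGraph V) (D : Set (Measure (∀ v, val v))) (X Y : Set V)
    (Φ : Measure (∀ v, val v) → (∀ v, val v) → (∀ v, val v) → ENNReal) : Prop :=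
  ∀ M : CausalModel val, M.Induces G → M.obs ∈ D →
    ∀ x y, M.effect X x Y y = Φ M.obs x y

/-- The causal effect of `X` on `Y` is identifiable in `G` from distributions of class `D`. -/
def Identifiable [Finite V] (G : MixedGraph V) (D : Set (Measure (∀ v, val v))) (X Y : Set V) :
    Prop :=
  ∃ Φ, Identifies G D X Y Φ

end Identification

/-!
The proof rests on two constructions of models and on one remark about interventions.

*Marginalization.* Given a model of `G`, make the variables in `Z` latent by substituting their
functions into the functions of the other variables (`CausalModel.marginalModel`). The function of
`v ∉ Z` then involves the vertices outside `Z` that have a directed path to `v` through `Z`, and the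
exogenous variables of all vertices that reach `v` through `Z`. In general such a substitution leads
to the latent projection. Since the latent projection is `G[V \ Z]`, each of those vertices is already a
parent of `v`, and vertices that come to share an exogenous variable are already joined by a
bidirected edge (`latentProjection_dir`, `latentProjection_bi`: loops are cut out of the obvious
walks, which preserves the edges at the ends and the absence of colliders). So the marginal model
induces `G[V \ Z]`, and its law is the marginal law.

*Interventions.* Consider the vertices from which `Y` can be reached by a walk that avoids `W`. Since
`W` intercepts all paths from `Z` to `Y`, none of them lies in `Z`. Their parents are of the same kind
or lie in `W`, where the values are fixed by the intervention, and `W` is disjoint from `Z`. So these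
vertices have no parents in `Z`, their functions are the same in both models, and both interventions
give the same values on `Y` for every value of the exogenous variables
(`CausalModel.Induces.effect_marginalModel`). This proves the first two claims, and that
identifiability in `G[V \ Z]` implies identifiability in `G`.

*Extension.* Conversely, a model of `G[V \ Z]` extends to a model of `G` in which the members of `Z`
are independent noise of full support (`CausalModel.extendModel`). The law of the extended model is
a function of the law of the given one, and is positive if that law is; the effects agree because `Y`
is disjoint from `Z`. So a formula for the effect in `G` yields one in `G[V \ Z]`
(`Identifiable.remove`).
-/

/-! ### Paths inside walks -/

namespace MixedGraph

variable {V : Type u} {G : MixedGraph V}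

namespace Walk

theorem start_mem_support {v w : V} (p : G.Walk v w) : v ∈ p.support := by
  cases p <;> simp [support]

theorem support_eq_cons {v w : V} (p : G.Walk v w) : p.support = v :: p.support.tail := by
  cases p <;> simp [support]

theorem support_eq_concat {v w : V} (p : G.Walk v w) :
    p.support = p.support.dropLast ++ [w] := by
  induction p with
  | nil v => rfl
  | cons l h p ih =>
    rw [support, List.dropLast_cons_of_ne_nil (List.ne_nil_of_mem p.start_mem_support),
      List.cons_append, ← ih]

theorem support_tail {v w : V} (p : G.Walk v w) (h : v ≠ w) :
    p.support.tail = p.interior ++ [w] := by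
  cases p with
  | nil => exact absurd rfl h
  | cons l hl p => exact p.support_eq_concat

theorem dropLast_support {v w : V} (p : G.Walk v w) (h : v ≠ w) :
    p.support.dropLast = v :: p.interior := by
  cases p with
  | nil => exact absurd rfl h
  | cons l hl p =>
    exact List.dropLast_cons_of_ne_nil (List.ne_nil_of_mem p.start_mem_support)

/-- A walk can be entered at any of its vertices. -/
theorem exists_suffix {v w m : V} (p : G.Walk v w) (hm : m ∈ p.support) :
    ∃ q : G.Walk m w, q.support <:+ p.support ∧ q.links <:+ p.links := by
  induction p with
  | nil v =>
    obtain rfl : m = v := by simpa [support] using hm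
    exact ⟨.nil m, List.suffix_refl _, List.suffix_refl _⟩
  | @cons v u w l h p ih =>
    by_cases hv : m = v
    · subst hv
      exact ⟨.cons l h p, List.suffix_refl _, List.suffix_refl _⟩
    · have hm' : m ∈ p.support := by
        rcases List.mem_cons.1 hm with h | h
        · exact absurd h hv
        · exact h
      obtain ⟨q, hq, hq'⟩ := ih hm'
      exact ⟨q, hq.trans (List.suffix_cons _ _), hq'.trans (List.suffix_cons _ _)⟩

/-- Cutting the loops out of a walk leaves a path. If an end of the walk is visited only once, the
edge at that end survives, so that arrowheads at the ends are preserved. -/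
theorem exists_isPath {v w : V} (p : G.Walk v w) :
    ∃ q : G.Walk v w, q.IsPath ∧ q.support.Sublist p.support ∧ q.links.Sublist p.links ∧
      (v ∉ p.support.tail → q.links.head? = p.links.head?) ∧
      (w ∉ p.support.dropLast → q.links.getLast? = p.links.getLast?) := by
  induction p with
  | nil v => exact ⟨.nil v, by simp [IsPath, support], by simp, by simp, by simp, by simp⟩
  | @cons v u w l h p ih =>
    obtain ⟨q, hq, hs, hl, -, hlast⟩ := ih
    by_cases hv : v ∈ q.support
    · obtain ⟨r, hr, hr'⟩ := q.exists_suffix hv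
      refine ⟨r, hr.sublist.nodup hq, (hr.sublist.trans hs).trans (List.sublist_cons_self _ _),
        (hr'.sublist.trans hl).trans (List.sublist_cons_self _ _),
        fun h' => absurd (hs.subset hv) h', fun hw => ?_⟩
      rw [support, List.dropLast_cons_of_ne_nil (List.ne_nil_of_mem p.start_mem_support),
        List.mem_cons, not_or] at hw
      have hrne : r.links ≠ [] := by
        cases r with
        | nil => exact absurd rfl hw.1
        | cons => simp [links]
      have hpne : p.links ≠ [] := by
        intro h0
        rw [h0, List.sublist_nil] at hl
        rw [hl, List.suffix_nil] at hr'
        exact hrne hr'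
      rw [links, List.getLast?_cons_of_ne_nil hpne, ← hlast hw.2]
      obtain ⟨t, ht⟩ := hr'
      rw [← ht, List.getLast?_append_of_ne_nil _ hrne]
    · refine ⟨.cons l h q, List.nodup_cons.2 ⟨hv, hq⟩, hs.cons_cons _, hl.cons_cons _,
        fun _ => rfl, fun hw => ?_⟩
      rw [support, List.dropLast_cons_of_ne_nil (List.ne_nil_of_mem p.start_mem_support),
        List.mem_cons, not_or] at hw
      rw [links, links, List.getLast?_cons, List.getLast?_cons, hlast hw.2]

/-- A path that visits a subsequence of the vertices of a walk with the same ends has its interior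
in the interior of the walk, because it does not return to its ends. -/
theorem IsPath.interior_subset {v w : V} {p q : G.Walk v w} (hq : q.IsPath)
    (h : q.support.Sublist p.support) {m : V} (hm : m ∈ q.interior) : m ∈ p.interior := by
  have hvw : v ≠ w := by
    rintro rfl
    cases q with
    | nil => simp [interior, support] at hm
    | cons l hl q =>
      rw [IsPath, support, List.nodup_cons, support_eq_concat] at hq
      exact hq.1 (by simp)
  have h1 : m ∈ q.support.tail := List.dropLast_subset _ hm
  have hv : m ≠ v := by
    rw [IsPath, support_eq_cons, List.nodup_cons] at hq
    rintro rfl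
    exact hq.1 h1
  have hw : m ≠ w := by
    rw [IsPath, support_eq_cons, List.nodup_cons, q.support_tail hvw, List.nodup_append] at hq
    exact hq.2.2.2 m hm w (by simp)
  have h2 : m ∈ p.support := h.subset (List.mem_of_mem_tail h1)
  rw [support_eq_cons, p.support_tail hvw] at h2
  simpa [hv, hw] using h2

/-- Absence of colliders passes to subsequences of the edges: it says that no edge with an arrowhead
at its end is followed, immediately or later, by an edge other than `→`. -/
theorem NoCollider.of_sublist {v w : V} {p q : G.Walk v w} (hp : p.NoCollider)
    (h : q.links.Sublist p.links) : q.NoCollider := by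
  let R : Link → Link → Prop := fun l l' => ¬ (l.HeadAtEnd ∧ l'.HeadAtStart)
  have : IsTrans Link R := ⟨by
    rintro (_ | _ | _) (_ | _ | _) (_ | _ | _) <;> simp [R, Link.HeadAtEnd, Link.HeadAtStart]⟩
  exact (List.isChain_iff_pairwise (R := R)).2
    (((List.isChain_iff_pairwise (R := R)).1 hp).sublist h)

end Walk

/-! ### Directed paths through latent vertices, and latent projections -/

/-- `a` reaches `v` along edges of the relation `r`, all of which leave from vertices in `Z`. Thus
all vertices but `v` lie in `Z`, and `a = v` is allowed. -/
def ReachesThrough (r : V → V → Prop) (Z : Set V) : V → V → Prop :=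
  Relation.ReflTransGen (fun a b => a ∈ Z ∧ r a b)

theorem ReachesThrough.eq_of_notMem {r : V → V → Prop} {Z : Set V} {a v : V}
    (h : ReachesThrough r Z a v) (ha : a ∉ Z) : a = v := by
  rcases Relation.ReflTransGen.cases_head h with h | ⟨b, h, -⟩
  · exact h
  · exact absurd h.1 ha

theorem ReachesThrough.exists_walk {Z : Set V} {a v : V} (h : ReachesThrough G.dir Z a v) :
    ∃ p : G.Walk a v, p.Directed ∧ ∀ m ∈ p.support.dropLast, m ∈ Z := by
  induction h using Relation.ReflTransGen.head_induction_on with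
  | refl => exact ⟨.nil v, by simp [Walk.Directed, Walk.links], by simp [Walk.support]⟩
  | @head a b hab _ ih =>
    obtain ⟨p, hp, hZ⟩ := ih
    have hj : G.Joined .right a b := hab.2
    refine ⟨.cons .right hj p, ?_, ?_⟩
    · intro l hl
      rcases List.mem_cons.1 hl with hl | hl
      · exact hl
      · exact hp l hl
    · rw [Walk.support,
        List.dropLast_cons_of_ne_nil (List.ne_nil_of_mem p.start_mem_support)]
      intro m hm
      rcases List.mem_cons.1 hm with rfl | hm
      · exact hab.1
      · exact hZ m hm

theorem Walk.Directed.noCollider {v w : V} {p : G.Walk v w} (hp : p.Directed) :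
    p.NoCollider := by
  refine List.Pairwise.isChain (List.pairwise_iff_forall_sublist.2 fun {l l'} h => ?_)
  rw [hp l' (h.subset (by simp))]
  exact fun h => h.2

theorem Walk.links_ne_nil {v w : V} (p : G.Walk v w) (h : v ≠ w) : p.links ≠ [] := by
  cases p with
  | nil => exact absurd rfl h
  | cons => simp [links]

theorem Walk.Directed.headAtEnd {v w : V} {p : G.Walk v w} (hp : p.Directed) :
    ∀ l ∈ p.links.getLast?, l.HeadAtEnd := by
  intro l hl
  rw [hp l (List.mem_of_getLast? hl)]
  trivial

/-- The edge `t → u` followed by a directed path through latent vertices is an edge of the latent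
projection. -/
theorem latentProjection_dir {Z : Set V} {t v : {v : V // v ∉ Z}} {u : V}
    (htv : (t : V) ≠ v) (htu : G.dir t u) (h : ReachesThrough G.dir Z u v) :
    (G.latentProjection Z).dir t v := by
  obtain ⟨p, hp, hZ⟩ := h.exists_walk
  obtain ⟨q, hq, hs, hl, -⟩ := (Walk.cons (G := G) .right htu p).exists_isPath
  refine ⟨fun h => htv (congrArg Subtype.val h), q, hq, fun m hm => ?_, fun l hl' => ?_⟩
  · exact hZ m (hq.interior_subset hs hm)
  · rcases List.mem_cons.1 (hl.subset hl') with h | h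
    · exact h
    · exact hp l h

/-- A walk without colliders from `a` to `w`, preceded by a directed path from `a` to `v` that is
traversed backwards, is again without colliders. It has an arrowhead at `v`, which comes from the
directed path unless that path is trivial. -/
theorem ReachesThrough.exists_trek {Z : Set V} {a v w : V} (h : ReachesThrough G.dir Z a v)
    (p : G.Walk a w) (hp : p.NoCollider) (hne : p.links ≠ []) (hZ : ∀ m ∈ p.interior, m ∈ Z)
    (hlast : ∀ l ∈ p.links.getLast?, l.HeadAtEnd)
    (hfirst : a = v → ∀ l ∈ p.links.head?, l.HeadAtStart) :
    ∃ q : G.Walk v w, q.NoCollider ∧ (∀ m ∈ q.interior, m ∈ Z) ∧ q.HeadsAtEnds := by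
  suffices h' : ∃ q : G.Walk v w, q.NoCollider ∧ q.links ≠ [] ∧ (∀ m ∈ q.interior, m ∈ Z) ∧
      (∀ l ∈ q.links.getLast?, l.HeadAtEnd) ∧ (v = a ∨ ∀ l ∈ q.links.head?, l.HeadAtStart) by
    obtain ⟨q, h1, h2, h3, h4, h5⟩ := h'
    rcases h5 with rfl | h5
    · exact ⟨p, hp, hZ, hfirst rfl, hlast⟩
    · exact ⟨q, h1, h3, h5, h4⟩
  clear hfirst
  induction h with
  | refl => exact ⟨p, hp, hne, hZ, hlast, Or.inl rfl⟩
  | @tail b c _ hbc ih =>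
    obtain ⟨q, h1, h2, h3, h4, -⟩ := ih
    have hj : G.Joined .left c b := hbc.2
    refine ⟨.cons .left hj q, ?_, by simp [Walk.links], ?_, ?_, Or.inr ?_⟩
    · exact List.isChain_cons.2 ⟨fun l _ h => h.1, h1⟩
    · intro m hm
      rw [Walk.interior, Walk.support, List.tail_cons] at hm
      cases q with
      | nil => exact absurd rfl h2
      | cons l hl r =>
        rw [Walk.support, List.dropLast_cons_of_ne_nil
          (List.ne_nil_of_mem r.start_mem_support)] at hm
        rcases List.mem_cons.1 hm with rfl | hm
        · exact hbc.1
        · exact h3 m hm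
    · rw [Walk.links, List.getLast?_cons_of_ne_nil h2]
      exact h4
    · simp [Walk.links, Link.HeadAtStart]

/-- Two vertices that depend on a common latent variable, possibly through vertices in `Z`, are
joined by a bidirected edge of the latent projection. -/
theorem latentProjection_bi {Z : Set V} {v w : {v : V // v ∉ Z}} (hvw : v ≠ w) {a b : V}
    (ha : ReachesThrough G.dir Z a v) (hb : ReachesThrough G.dir Z b w)
    (hab : a = b ∨ G.bi a b) : (G.latentProjection Z).bi v w := by
  have hvw' : (v : V) ≠ w := fun h => hvw (Subtype.ext h)
  obtain ⟨p, h1, h2, h3⟩ : ∃ p : G.Walk v w,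
      p.NoCollider ∧ (∀ m ∈ p.interior, m ∈ Z) ∧ p.HeadsAtEnds := by
    obtain ⟨q, hq, hqZ⟩ := hb.exists_walk
    rcases hab with rfl | hab
    · have hav : a ≠ v := fun h => hvw' (h ▸ hb.eq_of_notMem (h ▸ v.2))
      have haw : a ≠ w := fun h => hvw' (h ▸ ha.eq_of_notMem (h ▸ w.2)).symm
      refine ha.exists_trek q hq.noCollider (q.links_ne_nil haw) (fun m hm => hqZ m ?_)
        hq.headAtEnd (fun h => absurd h hav)
      rw [Walk.interior, ← List.tail_dropLast] at hm
      exact List.mem_of_mem_tail hm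
    · refine ha.exists_trek (.cons .both hab q) ?_ (by simp [Walk.links]) hqZ ?_ ?_
      · refine List.isChain_cons.2 ⟨fun l hl h => ?_, hq.noCollider⟩
        rw [hq l (List.mem_of_mem_head? hl)] at h
        exact h.2
      · intro l hl
        rcases List.mem_cons.1 (List.mem_of_getLast? hl) with h | h
        · rw [h]
          trivial
        · rw [hq l h]
          trivial
      · simp [Walk.links, Link.HeadAtStart]
  obtain ⟨q, hq, hs, hl, hhead, hlast⟩ := p.exists_isPath
  -- `v` and `w` lie outside `Z`, hence outside the interior: the end edges of `p` survive in `q`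
  have hv : (v : V) ∉ p.support.tail := by
    rw [p.support_tail hvw']
    simpa [hvw'] using fun h => v.2 (h2 _ h)
  have hw : (w : V) ∉ p.support.dropLast := by
    rw [p.dropLast_support hvw']
    simpa [hvw'.symm] using fun h => w.2 (h2 _ h)
  refine ⟨hvw, q, hq, fun m hm => h2 m (hq.interior_subset hs hm), h1.of_sublist hl, ?_, ?_⟩
  · rw [hhead hv]
    exact h3.1
  · rw [hlast hw]
    exact h3.2

/-- No walk that avoids `W` leads from `Z` to `Y` if `W` intercepts all paths. -/
theorem Intercepts.notMem {W Z Y : Set V} (h : G.Intercepts W Z Y) {v y : V} (hy : y ∈ Y)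
    (p : G.Walk v y) (hp : ∀ m ∈ p.support, m ∉ W) : v ∉ Z := by
  intro hv
  obtain ⟨q, hq, hs, -⟩ := p.exists_isPath
  obtain ⟨w, hw, hw'⟩ := h v hv y hy q hq
  exact hp w (hs.subset hw') hw

end MixedGraph

/-! ### Interventions and marginal models -/

open Classical in
/-- An assignment of values to the indices with property `p`, extended by arbitrary values. -/
noncomputable def extendArbitrary {ι : Type*} {β : ι → Type*} [∀ i, Nonempty (β i)] (p : ι → Prop)
    (a : ∀ i : {i // p i}, β i) : ∀ i, β i :=
  fun i => if h : p i then a ⟨i, h⟩ else Classical.arbitrary _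

theorem extendArbitrary_of_pos {ι : Type*} {β : ι → Type*} [∀ i, Nonempty (β i)] {p : ι → Prop}
    (a : ∀ i : {i // p i}, β i) {i : ι} (h : p i) : extendArbitrary p a i = a ⟨i, h⟩ :=
  dif_pos h

theorem measurable_extendArbitrary {ι : Type*} {β : ι → Type*} [∀ i, Nonempty (β i)]
    [∀ i, MeasurableSpace (β i)] (p : ι → Prop) :
    Measurable (extendArbitrary (β := β) p) := by
  refine measurable_pi_iff.2 fun i => ?_
  by_cases h : p i
  · simp only [extendArbitrary_of_pos _ h]
    exact measurable_pi_apply _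
  · simp only [extendArbitrary, dif_neg h]
    exact measurable_const

namespace CausalModel

variable {V : Type u} {val : V → Type u} [∀ v, MeasurableSpace (val v)]

/-- The solution of the submodel for `do(X = x)`, as a function of the exogenous variables of the
original model. -/
noncomputable def solutionDo [Finite V] (M : CausalModel val) (X : Set V) (x : ∀ v, val v)
    (e : ∀ i, M.exo i) : ∀ v, val v :=
  (M.intervene X x).solution e

theorem solutionDo_of_mem [Finite V] (M : CausalModel val) {X : Set V} (x : ∀ v, val v)
    (e : ∀ i, M.exo i) {v : V} (hv : v ∈ X) : M.solutionDo X x e v = x v :=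
  ((M.intervene X x).solution_eq e v).trans (if_pos hv)

theorem solutionDo_of_notMem [Finite V] (M : CausalModel val) {X : Set V} (x : ∀ v, val v)
    (e : ∀ i, M.exo i) {v : V} (hv : v ∉ X) : M.solutionDo X x e v =
      M.f v (fun w => M.solutionDo X x e w.1) (fun i => e i.1) :=
  ((M.intervene X x).solution_eq e v).trans (if_neg hv)

theorem measurable_solutionDo [Finite V] (M : CausalModel val) (X : Set V)
    (x : ∀ v, val v) : Measurable (M.solutionDo X x) :=
  (M.intervene X x).measurable_solution

theorem measurableSet_agree [Finite V] [∀ v, MeasurableSingletonClass (val v)] (Y : Set V)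
    (y : ∀ v, val v) : MeasurableSet {ω : ∀ v, val v | ∀ v ∈ Y, ω v = y v} := by
  simp only [Set.ofPred_forall]
  exact MeasurableSet.iInter fun v => MeasurableSet.iInter fun _ =>
    measurable_pi_apply v (measurableSet_singleton (y v))

theorem effect_eq [Finite V] [∀ v, MeasurableSingletonClass (val v)] (M : CausalModel val)
    (X : Set V) (x : ∀ v, val v) (Y : Set V) (y : ∀ v, val v) :
    M.effect X x Y y =
      Measure.pi M.law {e | ∀ v ∈ Y, M.solutionDo X x e v = y v} :=
  Measure.map_apply (M.measurable_solutionDo X x) (measurableSet_agree Y y)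

theorem Induces.dir_eq {G : MixedGraph V} {M : CausalModel val} (hM : M.Induces G) :
    G.dir = M.pa :=
  funext fun v => funext fun w => propext (hM.1 v w)

theorem nonempty_exo (M : CausalModel val) (i : M.U) : Nonempty (M.exo i) :=
  nonempty_of_isProbabilityMeasure (M.law i)

section MarginalModel

variable [Finite V] [∀ v, MeasurableSingletonClass (val v)] [∀ v, Countable (val v)]
  [∀ v, Nonempty (val v)]

attribute [local instance] nonempty_exo

/-- The model in which the variables in `Z` have become latent: the functions of the members of `Z`
are substituted for them in the other functions. The function of `v` computes the value of `v` after
the other variables outside `Z` have been fixed; it is allowed to depend only on the parents of `v`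
outside `Z` and on the exogenous variables that reach `v` through `Z`, the remaining arguments being
replaced by arbitrary values. The law of this model is the marginal distribution if the parents
outside `Z` include all variables from which a directed path leads to `v` through `Z`. -/
noncomputable abbrev marginalModel (M : CausalModel val) (Z : Set V) :
    CausalModel (fun v : {v : V // v ∉ Z} => val v) where
  pa v w := M.pa v w
  acyclic v h := M.acyclic v (h.lift Subtype.val fun _ _ h => h)
  U := M.U
  fintypeU := M.fintypeU
  exo := M.exo
  measurableSpaceExo := M.measurableSpaceExo
  law := M.law
  isProbability := M.isProbability
  lat i v := ∃ a, MixedGraph.ReachesThrough M.pa Z a v ∧ M.lat i a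
  f v a e := M.solutionDo {w | w ∉ Z ∧ w ≠ v}
    (extendArbitrary (· ∉ Z) (extendArbitrary (β := fun w : {v : V // v ∉ Z} => val w)
      (fun w => M.pa w v) a)) (extendArbitrary _ e) v
  measurable_f v := by
    refine measurable_from_prod_countable_right fun a => ?_
    have h := (M.measurable_solutionDo {w | w ∉ Z ∧ w ≠ v}
      (extendArbitrary (· ∉ Z) (extendArbitrary (β := fun w : {v : V // v ∉ Z} => val w)
        (fun w => M.pa w v) a))).comp (measurable_extendArbitrary
          fun i => ∃ a, MixedGraph.ReachesThrough M.pa Z a v ∧ M.lat i a)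
    exact (measurable_pi_apply (v : V)).comp h

/-- At a vertex without parents in `Z`, the function of the marginal model is the original one. -/
theorem marginalModel_f_eq (M : CausalModel val) (Z : Set V) (v : {v : V // v ∉ Z})
    (hv : ∀ w, M.pa w v → w ∉ Z) (a : ∀ v : {v : V // v ∉ Z}, val v) (b : ∀ v, val v)
    (hab : ∀ w, ∀ h : M.pa w v, b w = a ⟨w, hv w h⟩) (e : ∀ i, M.exo i) :
    (M.marginalModel Z).f v (fun w => a w.1) (fun i => e i.1) =
      M.f v (fun w => b w.1) (fun i => e i.1) := by
  refine (M.solutionDo_of_notMem _ _ (fun h => h.2 rfl)).trans ?_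
  congr 1
  · funext w
    have hmem : w.1 ∈ {w | w ∉ Z ∧ w ≠ v} := by
      refine ⟨hv w.1 w.2, fun h => M.acyclic v (.single ?_)⟩
      have hw := w.2
      rwa [h] at hw
    rw [solutionDo_of_mem _ _ _ hmem, hab w.1 w.2]
    exact (extendArbitrary_of_pos (p := (· ∉ Z)) _ (hv w.1 w.2)).trans
      (extendArbitrary_of_pos (p := fun w : {v : V // v ∉ Z} => M.pa w v) _ w.2)
  · funext i
    exact extendArbitrary_of_pos (p := fun i => (M.marginalModel Z).lat i v) _
      ⟨v, Relation.ReflTransGen.refl, i.2⟩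

/-- If every directed path through `Z` is accompanied by an edge, the marginal model produces the
same values outside `Z`. -/
theorem solution_marginalModel (M : CausalModel val) (Z : Set V)
    (hpa : ∀ (t v : {v : V // v ∉ Z}) (u : V), (t : V) ≠ v → M.pa t u →
      MixedGraph.ReachesThrough M.pa Z u v → M.pa t v)
    (e : ∀ i, M.exo i) : (M.marginalModel Z).solution e = restrictOff Z (M.solution e) := by
  funext v
  induction v using (M.marginalModel Z).wellFounded_pa.induction with
  | _ v ih =>
  rw [(M.marginalModel Z).solution_eq]
  -- the vertices of the directed paths through `Z` to `v` take their original values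
  suffices h : ∀ u, MixedGraph.ReachesThrough M.pa Z u v →
      M.solutionDo {w | w ∉ Z ∧ w ≠ v} (extendArbitrary (· ∉ Z)
        (extendArbitrary (β := fun w : {v : V // v ∉ Z} => val w) (fun w => M.pa w v)
          fun w => (M.marginalModel Z).solution e w.1))
        (extendArbitrary (fun i => (M.marginalModel Z).lat i v) fun i => e i.1) u =
      M.solution e u from h v Relation.ReflTransGen.refl
  intro u
  induction u using M.wellFounded_pa.induction with
  | _ u ih' =>
  intro hu
  have hmem : u ∉ {w | w ∉ Z ∧ w ≠ v} := fun h => h.2 (hu.eq_of_notMem h.1)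
  rw [solutionDo_of_notMem _ _ _ hmem, solution_eq M]
  congr 1
  · funext w
    obtain ⟨w, hwu⟩ := w
    by_cases hw : w ∈ Z
    · exact ih' w hwu (Relation.ReflTransGen.head ⟨hw, hwu⟩ hu)
    · have hwv : w ≠ v := by
        rintro rfl
        exact M.acyclic _ (Relation.TransGen.trans_left (.single hwu)
          (Relation.ReflTransGen.mono (fun _ _ h => h.2) _ _ hu))
      have hwv' : M.pa w v := hpa ⟨w, hw⟩ v u hwv hwu hu
      have hmem : w ∈ {w | w ∉ Z ∧ w ≠ v} := ⟨hw, hwv⟩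
      rw [solutionDo_of_mem _ _ _ hmem]
      refine (extendArbitrary_of_pos (p := (· ∉ Z)) _ hw).trans ?_
      refine (extendArbitrary_of_pos (p := fun w : {v : V // v ∉ Z} => M.pa w v)
        (i := ⟨w, hw⟩) _ hwv').trans ?_
      exact ih ⟨w, hw⟩ hwv'
  · funext i
    exact extendArbitrary_of_pos _ ⟨u, hu, i.2⟩

end MarginalModel

end CausalModel

theorem measurable_restrictOff {V : Type u} {val : V → Type u} [∀ v, MeasurableSpace (val v)]
    (Z : Set V) : Measurable (restrictOff (val := val) Z) :=
  measurable_pi_iff.2 fun v => measurable_pi_apply (v : V)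

theorem restrictOff_extendArbitrary {V : Type u} {val : V → Type u} [∀ v, Nonempty (val v)]
    (Z : Set V) (a : ∀ v : {v : V // v ∉ Z}, val v) :
    restrictOff Z (extendArbitrary (· ∉ Z) a) = a :=
  funext fun v => extendArbitrary_of_pos a v.2

/-! ### The effect in the marginal model -/

namespace CausalModel

variable {V : Type u} {val : V → Type u} [∀ v, MeasurableSpace (val v)]
  [Finite V] [∀ v, MeasurableSingletonClass (val v)] [∀ v, Countable (val v)]
  [∀ v, Nonempty (val v)] {G : MixedGraph V} {M : CausalModel val} {Z : Set V}

theorem Induces.marginalModel (hM : M.Induces G) (hproj : G.remove Z = G.latentProjection Z) :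
    (M.marginalModel Z).Induces (G.remove Z) := by
  refine ⟨fun v w => hM.1 v w, fun v w => ⟨fun h => ?_, ?_⟩⟩
  · obtain ⟨h1, i, h2, h3⟩ := (hM.2 v w).1 h
    exact ⟨fun h => h1 (congrArg Subtype.val h), i, ⟨v, .refl, h2⟩, ⟨w, .refl, h3⟩⟩
  · rintro ⟨hvw, i, ⟨a, ha, hia⟩, ⟨b, hb, hib⟩⟩
    rw [hproj]
    rw [← hM.dir_eq] at ha hb
    refine MixedGraph.latentProjection_bi hvw ha hb ?_
    by_cases h : a = b
    · exact Or.inl h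
    · exact Or.inr ((hM.2 a b).2 ⟨h, i, hia, hib⟩)

theorem Induces.obs_marginalModel (hM : M.Induces G)
    (hproj : G.remove Z = G.latentProjection Z) :
    (M.marginalModel Z).obs = marginalOff Z M.obs := by
  have hsol := M.solution_marginalModel Z (fun t v u htv htu hu => by
    rw [← hM.dir_eq] at htu hu
    have h := MixedGraph.latentProjection_dir htv htu hu
    rw [← hproj] at h
    exact (hM.1 t v).1 h)
  rw [marginalOff, obs, obs, Measure.map_map (measurable_restrictOff Z) M.measurable_solution]
  exact congrArg (Measure.map · _) (funext hsol)

/-- The interventions on `X` in the model and on `X \ Z` in the marginal model produce the same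
values on `Y`. The induction along the directed edges runs over `W` and the vertices with a walk to
`Y` outside `W`. The latter have no parents in `Z`, and so the same functions in both models. -/
theorem Induces.effect_marginalModel (hM : M.Induces G) {X Y W : Set V} (hXY : Disjoint X Y)
    (hWX : W ⊆ X) (hZ : G.Intercepts W Z Y) (hZW : Disjoint Z W) (x y : ∀ v, val v) :
    M.effect X x Y y =
      (M.marginalModel Z).effect (Subtype.val ⁻¹' (X \ Z)) (restrictOff Z x)
        (Subtype.val ⁻¹' Y) (restrictOff Z y) := by
  have hYW : ∀ v ∈ Y, v ∉ W := fun v hv hw => hXY.notMem_of_mem_left (hWX hw) hv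
  have hYZ : ∀ v ∈ Y, v ∉ Z := fun v hv =>
    hZ.notMem hv (.nil v) (by simpa [MixedGraph.Walk.support] using hYW v hv)
  have key : ∀ (e : ∀ i, M.exo i) (v : {v : V // v ∉ Z}),
      ((v : V) ∈ W ∨ ∃ t ∈ Y, ∃ p : G.Walk v t, ∀ m ∈ p.support, m ∉ W) →
      M.solutionDo X x e v = (M.marginalModel Z).solutionDo (Subtype.val ⁻¹' (X \ Z))
        (restrictOff Z x) e v := by
    intro e v
    induction v using (M.marginalModel Z).wellFounded_pa.induction with
    | _ v ih =>
    intro hv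
    by_cases hvX : (v : V) ∈ X
    · rw [solutionDo_of_mem _ _ _ hvX]
      exact (solutionDo_of_mem (M.marginalModel Z) (restrictOff Z x) e
        (X := Subtype.val ⁻¹' (X \ Z)) (v := v) ⟨hvX, v.2⟩).symm
    · obtain ⟨t, ht, p, hp⟩ := hv.resolve_left fun h => hvX (hWX h)
      have hpar : ∀ w, M.pa w v → w ∈ W ∨ ∃ t ∈ Y, ∃ p : G.Walk w t, ∀ m ∈ p.support, m ∉ W := by
        intro w hw
        by_cases hwW : w ∈ W
        · exact Or.inl hwW
        · refine Or.inr ⟨t, ht, .cons .right ((hM.1 w v).2 hw) p, fun m hm => ?_⟩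
          rcases List.mem_cons.1 hm with rfl | hm
          · exact hwW
          · exact hp m hm
      have hparZ : ∀ w, M.pa w v → w ∉ Z := by
        intro w hw
        rcases hpar w hw with h | ⟨s, hs, q, hq⟩
        · exact hZW.notMem_of_mem_right h
        · exact hZ.notMem hs q hq
      rw [solutionDo_of_notMem _ _ _ hvX]
      refine Eq.trans ?_ (solutionDo_of_notMem (M.marginalModel Z) (restrictOff Z x) e
        (X := Subtype.val ⁻¹' (X \ Z)) (v := v) fun h => hvX h.1).symm
      exact (M.marginalModel_f_eq Z v hparZ _ _
        (fun w hw => ih ⟨w, hparZ w hw⟩ hw (hpar w hw)) e).symm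
  rw [effect_eq, effect_eq]
  refine congrArg (Measure.pi M.law) (Set.ext fun e => ⟨fun h v hv => ?_, fun h v hv => ?_⟩)
  · refine (key e v (Or.inr ⟨v, hv, .nil _, ?_⟩)).symm.trans (h v hv)
    simpa [MixedGraph.Walk.support] using hYW v hv
  · refine (key e ⟨v, hYZ v hv⟩ (Or.inr ⟨v, hv, .nil _, ?_⟩)).trans (h ⟨v, hYZ v hv⟩ hv)
    simpa [MixedGraph.Walk.support] using hYW v hv

end CausalModel

/-! ### Adding variables to a model -/

instance neZero_count_of_nonempty {α : Type*} [MeasurableSpace α] [MeasurableSingletonClass α]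
    [Nonempty α] : NeZero (Measure.count : Measure α) :=
  ⟨fun h => by
    have := Measure.count_singleton (Classical.arbitrary α)
    simp [h] at this⟩

/-- On a nonempty countable space, a probability measure that charges every point. -/
noncomputable def fullSupport (α : Type*) [MeasurableSpace α] [MeasurableSingletonClass α]
    [Countable α] : Measure α :=
  (Measure.count : Measure α).toFinite

instance isProbabilityMeasure_fullSupport (α : Type*) [MeasurableSpace α]
    [MeasurableSingletonClass α] [Countable α] [Nonempty α] :
    IsProbabilityMeasure (fullSupport α) :=
  inferInstanceAs (IsProbabilityMeasure (Measure.count : Measure α).toFinite)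

theorem fullSupport_singleton_ne_zero {α : Type*} [MeasurableSpace α] [MeasurableSingletonClass α]
    [Countable α] (a : α) : fullSupport α {a} ≠ 0 := by
  rw [fullSupport, Ne, toFinite_apply_eq_zero_iff, Measure.count_singleton]
  exact one_ne_zero

theorem marginalOff_mem_positiveDistributions {V : Type u} [Finite V] {val : V → Type u}
    [∀ v, MeasurableSpace (val v)] [∀ v, MeasurableSingletonClass (val v)]
    [∀ v, Nonempty (val v)] {Z : Set V} {P : Measure (∀ v, val v)}
    (hP : P ∈ positiveDistributions val) :
    marginalOff Z P ∈ positiveDistributions (fun v : {v : V // v ∉ Z} => val v) := by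
  intro a
  rw [marginalOff, Measure.map_apply (measurable_restrictOff Z) (measurableSet_singleton a)]
  refine (hP (extendArbitrary (· ∉ Z) a)).trans_le (measure_mono ?_)
  rintro _ rfl
  exact restrictOff_extendArbitrary Z a

namespace CausalModel

open Classical in
/-- The values in the extended model, as a function of the values in the given model and of the
noise. -/
noncomputable def attachNoise {V : Type u} {val : V → Type u} (Z : Set V)
    (ω : (∀ v : {v : V // v ∉ Z}, val v) × (∀ p : V × V, val p.1)) : ∀ v, val v :=
  fun v => if h : v ∈ Z then ω.2 (v, v) else ω.1 ⟨v, h⟩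

section

variable {V : Type u} {val : V → Type u} {Z : Set V}
  (ω : (∀ v : {v : V // v ∉ Z}, val v) × (∀ p : V × V, val p.1))

theorem attachNoise_of_mem {v : V} (h : v ∈ Z) : attachNoise Z ω v = ω.2 (v, v) :=
  dif_pos h

theorem attachNoise_of_notMem {v : V} (h : v ∉ Z) : attachNoise Z ω v = ω.1 ⟨v, h⟩ :=
  dif_neg h

theorem measurable_attachNoise [∀ v, MeasurableSpace (val v)] :
    Measurable (attachNoise (val := val) Z) := by
  refine measurable_pi_iff.2 fun v => ?_
  by_cases h : v ∈ Z
  · simp only [attachNoise_of_mem _ h]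
    exact (measurable_pi_apply (v, v)).comp measurable_snd
  · simp only [attachNoise_of_notMem _ h]
    exact (measurable_pi_apply _).comp measurable_fst

end

variable {V : Type u} {val : V → Type u} [∀ v, MeasurableSpace (val v)]
  [∀ v, MeasurableSingletonClass (val v)] [∀ v, Countable (val v)] [∀ v, Nonempty (val v)]
  {G : MixedGraph V} {Z : Set V}

section

variable (M : CausalModel (fun v : {v : V // v ∉ Z} => val v))

/-- The domains of the exogenous variables of `extendModel`: those of the given model, and a
variable with the domain of `v` for every pair `(v, w)`. -/
abbrev noiseExo : M.U ⊕ V × V → Type u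
  | .inl i => M.exo i
  | .inr p => val p.1

instance measurableSpaceNoise : ∀ i, MeasurableSpace (M.noiseExo i)
  | .inl i => M.measurableSpaceExo i
  | .inr p => inferInstanceAs (MeasurableSpace (val p.1))

/-- The laws of the exogenous variables of `extendModel`. -/
noncomputable def noiseLaw : ∀ i, Measure (M.noiseExo i)
  | .inl i => M.law i
  | .inr p => fullSupport (val p.1)

instance isProbability_noiseLaw : ∀ i, IsProbabilityMeasure (M.noiseLaw i)
  | .inl i => M.isProbability i
  | .inr p => inferInstanceAs (IsProbabilityMeasure (fullSupport (val p.1)))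

theorem measurePreserving_noise [Fintype V] [I : Fintype (M.U ⊕ V × V)] :
    MeasurePreserving (fun e : ∀ i, M.noiseExo i =>
        ((fun i => e (.inl i) : ∀ i, M.exo i), (fun p => e (.inr p) : ∀ p : V × V, val p.1)))
      (Measure.pi M.noiseLaw)
      ((Measure.pi M.law).prod (Measure.pi fun p : V × V => fullSupport (val p.1))) := by
  obtain rfl : I = instFintypeSum M.U (V × V) := Subsingleton.elim _ _
  exact measurePreserving_sumPiEquivProdPi M.noiseLaw

/-- The functions of the extended model in which the exogenous variable `i` occurs. A pair `(z, z)`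
stands for the noise that determines `z ∈ Z`; a pair of distinct vertices stands for a bidirected
edge with an end in `Z`. -/
def NoiseLat (G : MixedGraph V) : M.U ⊕ V × V → V → Prop
  | .inl i, v => ∃ h : v ∉ Z, M.lat i ⟨v, h⟩
  | .inr p, v => (v = p.1 ∨ v = p.2) ∧ (p.1 ∈ Z ∨ p.2 ∈ Z) ∧ (p.1 = p.2 ∨ G.bi p.1 p.2)

variable [Finite V]

open Classical in
/-- An extension of a model of `G[V \ Z]` to a model of `G`: the members of `Z` are independent noise
that does not influence the other variables, although it is among the arguments of their
functions. -/
noncomputable abbrev extendModel (hM : M.Induces (G.remove Z))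
    (hG : ∀ v, ¬ Relation.TransGen G.dir v v) : CausalModel val where
  pa := G.dir
  acyclic := hG
  U := M.U ⊕ V × V
  fintypeU := Fintype.ofFinite _
  exo := M.noiseExo
  measurableSpaceExo := M.measurableSpaceNoise
  law := M.noiseLaw
  isProbability := M.isProbability_noiseLaw
  lat := M.NoiseLat G
  f v a e := if h : v ∈ Z then e ⟨.inr (v, v), Or.inl rfl, Or.inl h, Or.inl rfl⟩ else
    M.f ⟨v, h⟩ (fun w => a ⟨w.1, (hM.1 w.1 ⟨v, h⟩).2 w.2⟩) (fun i => e ⟨.inl i.1, h, i.2⟩)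
  measurable_f v := by
    by_cases h : v ∈ Z
    · simp only [h, dif_pos]
      exact (measurable_pi_apply (⟨.inr (v, v), _⟩ : {i // M.NoiseLat G i v})).comp measurable_snd
    · simp only [h, dif_neg, not_false_iff]
      refine (M.measurable_f ⟨v, h⟩).comp (Measurable.prodMk ?_ ?_)
      · exact measurable_pi_iff.2 fun w => (measurable_pi_apply _).comp measurable_fst
      · exact measurable_pi_iff.2 fun i => (measurable_pi_apply
          (⟨.inl i.1, _⟩ : {i // M.NoiseLat G i v})).comp measurable_snd

end

variable [Finite V] {M : CausalModel (fun v : {v : V // v ∉ Z} => val v)}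

theorem Induces.extendModel (hM : M.Induces (G.remove Z)) (hG : G.IsSMG) :
    (M.extendModel hM hG.acyclic).Induces G := by
  refine ⟨fun v w => Iff.rfl, fun v w => ⟨fun h => ?_, ?_⟩⟩
  · have hvw : v ≠ w := fun h' => hG.bi_irrefl v (by rwa [← h'] at h)
    refine ⟨hvw, ?_⟩
    by_cases hZ : v ∈ Z ∨ w ∈ Z
    · exact ⟨.inr (v, w), ⟨Or.inl rfl, hZ, Or.inr h⟩, ⟨Or.inr rfl, hZ, Or.inr h⟩⟩
    · rw [not_or] at hZ
      obtain ⟨-, i, hv, hw⟩ := (hM.2 ⟨v, hZ.1⟩ ⟨w, hZ.2⟩).1 h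
      exact ⟨.inl i, ⟨hZ.1, hv⟩, ⟨hZ.2, hw⟩⟩
  · rintro ⟨hvw, i | ⟨a, b⟩, hv, hw⟩
    · obtain ⟨hvZ, hv⟩ := hv
      obtain ⟨hwZ, hw⟩ := hw
      exact (hM.2 ⟨v, hvZ⟩ ⟨w, hwZ⟩).2 ⟨fun h => hvw (congrArg Subtype.val h), i, hv, hw⟩
    · obtain ⟨h1 | h1, -, h2⟩ := hv <;> obtain ⟨h3 | h3, -⟩ := hw <;> dsimp only at h1 h2 h3 <;>
        subst h1 <;> subst h3
      · exact absurd rfl hvw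
      · exact h2.resolve_left hvw
      · exact hG.bi_symm _ _ (h2.resolve_left hvw.symm)
      · exact absurd rfl hvw

theorem solution_extendModel (hM : M.Induces (G.remove Z))
    (hG : ∀ v, ¬ Relation.TransGen G.dir v v) (e : ∀ i, M.noiseExo i) :
    (M.extendModel hM hG).solution e =
      attachNoise Z (M.solution fun i => e (.inl i), fun p => e (.inr p)) := by
  funext v
  induction v using (M.extendModel hM hG).wellFounded_pa.induction with
  | _ v ih =>
  rw [(M.extendModel hM hG).solution_eq]
  by_cases hv : v ∈ Z
  · rw [attachNoise_of_mem _ hv]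
    exact dif_pos hv
  · rw [attachNoise_of_notMem _ hv]
    refine (dif_neg hv).trans (Eq.trans ?_ (M.solution_eq (fun i => e (.inl i)) ⟨v, hv⟩).symm)
    congr 1
    funext w
    exact (ih w.1 ((hM.1 w.1 ⟨v, hv⟩).2 w.2)).trans (attachNoise_of_notMem _ w.1.2)

theorem solutionDo_extendModel (hM : M.Induces (G.remove Z))
    (hG : ∀ v, ¬ Relation.TransGen G.dir v v) (X : Set V) (x : ∀ v, val v)
    (e : ∀ i, M.noiseExo i) (v : {v : V // v ∉ Z}) :
    (M.extendModel hM hG).solutionDo X x e v =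
      M.solutionDo (Subtype.val ⁻¹' (X \ Z)) (restrictOff Z x) (fun i => e (.inl i)) v := by
  induction v using M.wellFounded_pa.induction with
  | _ v ih =>
  by_cases hv : (v : V) ∈ X
  · rw [solutionDo_of_mem _ _ _ hv]
    exact (solutionDo_of_mem M (restrictOff Z x) _ (X := Subtype.val ⁻¹' (X \ Z)) (v := v)
      ⟨hv, v.2⟩).symm
  · rw [solutionDo_of_notMem _ _ _ hv]
    refine Eq.trans ?_ (solutionDo_of_notMem M (restrictOff Z x) _
      (X := Subtype.val ⁻¹' (X \ Z)) (v := v) fun h => hv h.1).symm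
    refine (dif_neg v.2).trans ?_
    congr 1
    funext w
    exact ih w.1 w.2

/-- The law of the extended model depends only on the law of the given model. -/
theorem obs_extendModel [Fintype V] (hM : M.Induces (G.remove Z))
    (hG : ∀ v, ¬ Relation.TransGen G.dir v v) :
    (M.extendModel hM hG).obs =
      (M.obs.prod (Measure.pi fun p : V × V => fullSupport (val p.1))).map (attachNoise Z) := by
  have hm : Measurable (Prod.map M.solution (id : (∀ p : V × V, val p.1) → _)) :=
    M.measurable_solution.prodMap measurable_id
  have hprod : M.obs.prod (Measure.pi fun p : V × V => fullSupport (val p.1)) =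
      ((Measure.pi M.law).prod (Measure.pi fun p : V × V => fullSupport (val p.1))).map
        (Prod.map M.solution id) := by
    rw [← Measure.map_prod_map _ _ M.measurable_solution measurable_id, Measure.map_id, obs]
  have hn := M.measurePreserving_noise (I := (M.extendModel hM hG).fintypeU)
  rw [hprod, ← hn.map_eq, Measure.map_map hm hn.measurable,
    Measure.map_map measurable_attachNoise (hm.comp hn.measurable)]
  exact congrArg (Measure.map · _) (funext (solution_extendModel hM hG))

theorem effect_extendModel (hM : M.Induces (G.remove Z))
    (hG : ∀ v, ¬ Relation.TransGen G.dir v v) (X : Set V) {Y : Set V} (hYZ : ∀ v ∈ Y, v ∉ Z)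
    (x y : ∀ v, val v) :
    (M.extendModel hM hG).effect X x Y y =
      M.effect (Subtype.val ⁻¹' (X \ Z)) (restrictOff Z x)
        (Subtype.val ⁻¹' Y) (restrictOff Z y) := by
  have := Fintype.ofFinite V
  have hp : MeasurePreserving (fun (e : ∀ i, M.noiseExo i) (i : M.U) => e (.inl i))
      (@Measure.pi _ _ (M.extendModel hM hG).fintypeU _ M.noiseLaw) (Measure.pi M.law) := by
    have hn := M.measurePreserving_noise (I := (M.extendModel hM hG).fintypeU)
    exact (@measurePreserving_fst _ _ _ _ (Measure.pi M.law) _ _).comp hn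
  have hm : MeasurableSet {e : ∀ i, M.exo i | ∀ v ∈ Subtype.val ⁻¹' Y,
      M.solutionDo (Subtype.val ⁻¹' (X \ Z)) (restrictOff Z x) e v = restrictOff Z y v} :=
    measurable_solutionDo M _ _ (measurableSet_agree (Subtype.val ⁻¹' Y) (restrictOff Z y))
  rw [effect_eq, effect_eq, ← hp.measure_preimage hm.nullMeasurableSet]
  have hset : {e : ∀ i, M.noiseExo i | ∀ v ∈ Y, (M.extendModel hM hG).solutionDo X x e v = y v} =
      (fun (e : ∀ i, M.noiseExo i) (i : M.U) => e (.inl i)) ⁻¹' {e | ∀ v ∈ Subtype.val ⁻¹' Y,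
        M.solutionDo (Subtype.val ⁻¹' (X \ Z)) (restrictOff Z x) e v = restrictOff Z y v} := by
    ext e
    refine ⟨fun h v hv => ?_, fun h v hv => ?_⟩
    · exact (solutionDo_extendModel hM hG X x e v).symm.trans (h v hv)
    · exact (solutionDo_extendModel hM hG X x e ⟨v, hYZ v hv⟩).trans (h ⟨v, hYZ v hv⟩ hv)
  exact congrArg (@Measure.pi _ _ (M.extendModel hM hG).fintypeU _ M.noiseLaw) hset

end CausalModel

/-! ### Transfer of positivity and identifiability -/

section Transfer

variable {V : Type u} [Finite V] {val : V → Type u} [∀ v, MeasurableSpace (val v)]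
  [∀ v, MeasurableSingletonClass (val v)] [∀ v, Countable (val v)] [∀ v, Nonempty (val v)]
  {G : MixedGraph V} {Z : Set V}

theorem map_attachNoise_mem_positiveDistributions [Fintype V]
    {P : Measure (∀ v : {v : V // v ∉ Z}, val v)}
    (hP : P ∈ positiveDistributions (fun v : {v : V // v ∉ Z} => val v)) :
    (P.prod (Measure.pi fun p : V × V => fullSupport (val p.1))).map
      (CausalModel.attachNoise Z) ∈ positiveDistributions val := by
  intro ω
  rw [Measure.map_apply CausalModel.measurable_attachNoise (measurableSet_singleton ω)]
  have hsub : {restrictOff Z ω} ×ˢ {fun p : V × V => ω p.1} ⊆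
      CausalModel.attachNoise (val := val) Z ⁻¹' {ω} := by
    rintro ⟨_, _⟩ ⟨rfl, rfl⟩
    funext v
    by_cases h : v ∈ Z
    · exact CausalModel.attachNoise_of_mem _ h
    · exact CausalModel.attachNoise_of_notMem _ h
  refine lt_of_lt_of_le ?_ (measure_mono hsub)
  rw [Measure.prod_prod, Measure.pi_singleton]
  exact ENNReal.mul_pos (hP _).ne' (Finset.prod_ne_zero_iff.2 fun p _ =>
    fullSupport_singleton_ne_zero _)

/-- If the effect can be computed in `G`, it can be computed in `G[V \ Z]`, from the law of the
extended model. -/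
theorem Identifiable.remove [Fintype V] (hG : G.IsSMG) {X Y : Set V} (hYZ : ∀ v ∈ Y, v ∉ Z)
    {D : Set (Measure (∀ v, val v))} {D' : Set (Measure (∀ v : {v : V // v ∉ Z}, val v))}
    (hD : ∀ P ∈ D', (P.prod (Measure.pi fun p : V × V => fullSupport (val p.1))).map
      (CausalModel.attachNoise Z) ∈ D) (h : Identifiable G D X Y) :
    Identifiable (G.remove Z) D' (Subtype.val ⁻¹' (X \ Z)) (Subtype.val ⁻¹' Y) := by
  obtain ⟨Φ, hΦ⟩ := h
  refine ⟨fun P x y => Φ ((P.prod (Measure.pi fun p : V × V => fullSupport (val p.1))).map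
    (CausalModel.attachNoise Z)) (extendArbitrary (· ∉ Z) x) (extendArbitrary (· ∉ Z) y),
    fun M hM hMD x y => ?_⟩
  have hobs := CausalModel.obs_extendModel hM hG.acyclic
  have h1 := CausalModel.effect_extendModel hM hG.acyclic X hYZ
    (extendArbitrary (· ∉ Z) x) (extendArbitrary (· ∉ Z) y)
  rw [restrictOff_extendArbitrary, restrictOff_extendArbitrary] at h1
  rw [← h1]
  dsimp only
  rw [← hobs]
  refine hΦ _ (hM.extendModel hG) ?_ _ _
  rw [hobs]
  exact hD _ hMD

end Transfer

theorem mainTheorem2 {V : Type u} [Finite V] (val : V → Type u)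
    [∀ v, MeasurableSpace (val v)] [∀ v, MeasurableSingletonClass (val v)]
    [∀ v, Countable (val v)] [∀ v, Nonempty (val v)]
    (G : MixedGraph V) (hG : G.IsSMG)
    (X Y W Z : Set V) (hXY : Disjoint X Y) (hWX : W ⊆ X)
    (hZ : G.Intercepts W Z Y)
    (hdesc : ∀ w ∈ W, ∀ a ∈ X \ W, ¬ Relation.TransGen G.dir w a)
    (hZW : Disjoint Z W)
    (hproj : G.remove Z = G.latentProjection Z) :
    -- the effect in any model of `G` is the effect in a model of `G[V \ Z]` with law `P(V \ Z)`
    (∀ M : CausalModel val, M.Induces G →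
      ∃ M' : CausalModel (fun v : {v : V // v ∉ Z} => val v),
        M'.Induces (G.remove Z) ∧ M'.obs = marginalOff Z M.obs ∧
        ∀ x y : (∀ v, val v),
          M.effect X x Y y =
            M'.effect (Subtype.val ⁻¹' (X \ Z)) (restrictOff Z x)
              (Subtype.val ⁻¹' Y) (restrictOff Z y)) ∧
    -- whatever computes the effect in `G[V \ Z]` computes it in `G`, from `P(V \ Z)`
    (∀ (D : Set (Measure (∀ v : {v : V // v ∉ Z}, val v))) (Φ),
      Identifies (G.remove Z) D (Subtype.val ⁻¹' (X \ Z)) (Subtype.val ⁻¹' Y) Φ →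
      Identifies G (marginalOff Z ⁻¹' D) X Y
        (fun P x y => Φ (marginalOff Z P) (restrictOff Z x) (restrictOff Z y))) ∧
    -- the effect is identifiable in `G` if and only if it is identifiable in `G[V \ Z]`
    (Identifiable (val := val) G Set.univ X Y ↔
      Identifiable (val := fun v : {v : V // v ∉ Z} => val v) (G.remove Z) Set.univ
        (Subtype.val ⁻¹' (X \ Z)) (Subtype.val ⁻¹' Y)) ∧
    (Identifiable G (positiveDistributions val) X Y ↔
      Identifiable (G.remove Z) (positiveDistributions (fun v : {v : V // v ∉ Z} => val v))
        (Subtype.val ⁻¹' (X \ Z)) (Subtype.val ⁻¹' Y)) := by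
  have := Fintype.ofFinite V
  have hYZ : ∀ v ∈ Y, v ∉ Z := fun v hv => hZ.notMem hv (.nil v) (by
    simpa [MixedGraph.Walk.support] using fun hw => hXY.notMem_of_mem_left (hWX hw) hv)
  have transfer : ∀ (D : Set (Measure (∀ v : {v : V // v ∉ Z}, val v))) (Φ),
      Identifies (G.remove Z) D (Subtype.val ⁻¹' (X \ Z)) (Subtype.val ⁻¹' Y) Φ →
      Identifies G (marginalOff Z ⁻¹' D) X Y
        (fun P x y => Φ (marginalOff Z P) (restrictOff Z x) (restrictOff Z y)) := by
    intro D Φ hΦ M hM hMD x y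
    have hobs := hM.obs_marginalModel hproj
    rw [hM.effect_marginalModel hXY hWX hZ hZW]
    dsimp only
    rw [← hobs]
    exact hΦ _ (hM.marginalModel hproj) (by rw [hobs]; exact hMD) _ _
  refine ⟨fun M hM => ⟨M.marginalModel Z, hM.marginalModel hproj, hM.obs_marginalModel hproj,
    hM.effect_marginalModel hXY hWX hZ hZW⟩, transfer, ⟨?_, ?_⟩, ⟨?_, ?_⟩⟩
  · exact Identifiable.remove hG hYZ fun _ _ => Set.mem_univ _
  · rintro ⟨Φ, hΦ⟩
    exact ⟨_, transfer _ Φ hΦ⟩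
  · exact Identifiable.remove hG hYZ fun _ => map_attachNoise_mem_positiveDistributions
  · rintro ⟨Φ, hΦ⟩
    exact ⟨fun P x y => Φ (marginalOff Z P) (restrictOff Z x) (restrictOff Z y), fun M hM hMD =>
      transfer _ Φ hΦ M hM (marginalOff_mem_positiveDistributions hMD)⟩
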